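/- Call a graph outerplanar if it can be drawn in the plane without crossing edges and with all vertices on the boundary of the external (unbounded) face. Let $G$ be a finite simple 2-connected outerplanar graph with $n$ vertices (2-connected: $G$ has at least three vertices, is connected, and remains connected after deleting any one vertex). Then $G$ contains an induced path with at least $\frac{\log_2 n}{2}$ vertices. -/

import Mathlib

open scoped unitInterval

/-- A graph is 2-connected if it has at least three vertices, is connected, and stays connected
after the removal of any one vertex. -/
def IsTwoConnected {V : Type*} (G : SimpleGraph V) : Prop :=
  3 ≤ Nat.card V ∧ G.Connected ∧ ∀ v : V, (G.induce {v}ᶜ).Connected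

/-- A drawing of `G` in the Euclidean plane without crossing edges: vertices are distinct points,
edges are simple (continuous, injective) arcs joining their two ends, an edge meets the vertices
only in its own ends, and two distinct edges meet only in vertices. -/
structure PlaneDrawing {V : Type*} (G : SimpleGraph V) where
  /-- the point representing a vertex -/
  vert : V → EuclideanSpace ℝ (Fin 2)
  /-- the arc representing an edge, in one of its two orientations -/
  edge : G.edgeSet → C(I, EuclideanSpace ℝ (Fin 2))
  vert_injective : Function.Injective vert
  edge_injective : ∀ e, Function.Injective (edge e)
  edge_ends : ∀ e : G.edgeSet, s(edge e 0, edge e 1) = (e : Sym2 V).map vert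
  mem_of_edge_eq_vert : ∀ (e : G.edgeSet) (t : I) (v : V), edge e t = vert v → v ∈ (e : Sym2 V)
  not_crossing : ∀ e f : G.edgeSet, e ≠ f → ∀ s t : I, edge e s = edge f t →
    edge e s ∈ Set.range vert

namespace PlaneDrawing

variable {V : Type*} {G : SimpleGraph V}

/-- The set of all points of the plane that lie on the drawing. -/
def carrier (D : PlaneDrawing G) : Set (EuclideanSpace ℝ (Fin 2)) :=
  Set.range D.vert ∪ ⋃ e, Set.range (D.edge e)

/-- The faces of a drawing are the connected components of the complement of the drawing. -/
def IsFace (D : PlaneDrawing G) (F : Set (EuclideanSpace ℝ (Fin 2))) : Prop :=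
  ∃ p ∈ D.carrierᶜ, F = connectedComponentIn D.carrierᶜ p

/-- An external face is an unbounded face (for a finite graph there is exactly one). -/
def IsExternalFace (D : PlaneDrawing G) (F : Set (EuclideanSpace ℝ (Fin 2))) : Prop :=
  D.IsFace F ∧ ¬ Bornology.IsBounded F

end PlaneDrawing

/-- A graph is outerplanar if it can be drawn in the plane without crossing edges and with all
vertices on (the boundary of) the external face. -/
def IsOuterplanar {V : Type*} (G : SimpleGraph V) : Prop :=
  ∃ (D : PlaneDrawing G) (F : Set (EuclideanSpace ℝ (Fin 2))),
    D.IsExternalFace F ∧ ∀ v : V, D.vert v ∈ frontier F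

/-- `G` contains an induced path of size `k` (that is, with `k` vertices): the path graph on `k`
vertices is isomorphic to an induced subgraph of `G`. -/
def HasInducedPath {V : Type*} (G : SimpleGraph V) (k : ℕ) : Prop :=
  (SimpleGraph.pathGraph k).IsIndContained G

/-! Topology: a point of the external face can be joined to every vertex of an outerplanar drawing,
so connected sets arranged like K₄ or K₂,₃ would yield drawings of K₅ or K₃,₃ (`not_four_linked`,
`not_two_three_linked`). These are excluded by parity. For disjoint arcs α, β the argument of α s -
β t is continuous on a square, so its changes along the boundary cancel; this gives one integer
relation per pair of independent edges (`exists_winding`), and all the relations together say that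
an odd number is even.

Combinatorics (`exists_two_induced_paths`): let C be a connected set whose outside neighbours are
the ends of an edge ab. A shortest walk from a to b through C closes to an induced cycle c 0, …, c
r. Each component of the rest of C is attached to the ends of exactly one edge c i c (i + 1), and
different components use different edges, so some component D satisfies |C| + 1 ≤ r (|D| + 1).
Induction on D gives paths from c i and c (i + 1); extending them along the cycle back to a and b
adds r - 1 edges in total. As r ≤ 2 ^ (r - 1), the two lengths sum to at least log₂ (|C| + 1). Since
G - {a, b} has at most two components, C can be chosen with n ≤ 2 (|C| + 1), and the longer path
suffices. -/

/-! ### Angle changes and winding relations for disjoint paths. -/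

section AngleChange

theorem exists_continuous_log {A : Type*} [TopologicalSpace A] [SimplyConnectedSpace A]
    [LocallyPathConnectedSpace A] (f : C(A, ℂ)) (hf : ∀ a, f a ≠ 0) :
    ∃ L : C(A, ℂ), ∀ a, Complex.exp (L a) = f a := by
  obtain ⟨a₀⟩ : Nonempty A := inferInstance
  obtain ⟨F, ⟨-, hF⟩, -⟩ := Complex.isCoveringMapOn_exp.existsUnique_continuousMap_lifts f
    (a₀ := a₀) (e₀ := Complex.log (f a₀)) (Complex.exp_log (hf a₀)) (fun a => by simpa using hf a)
  exact ⟨F, fun a => congrFun hF a⟩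

/-- By uniqueness of lifts through `exp`, two logarithms of one function differ by a constant. Hence
`angleChange` does not depend on the logarithm chosen. -/
theorem sub_eq_sub_of_exp_eq {L L' : C(ℝ, ℂ)} (h : ∀ t, Complex.exp (L t) = Complex.exp (L' t))
    (s t : ℝ) : L t - L s = L' t - L' s := by
  let f : C(ℝ, ℂ) := ⟨fun t => Complex.exp (L t), by fun_prop⟩
  have key := Complex.isCoveringMapOn_exp.existsUnique_continuousMap_lifts f
    (a₀ := s) (e₀ := L s) rfl (fun a => by simp [f])
  have h1 : L' + ContinuousMap.const ℝ (L s - L' s) = L := by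
    refine key.unique ⟨by simp, ?_⟩ ⟨rfl, rfl⟩
    ext t
    simp [f, Complex.exp_add, Complex.exp_sub, h]
  have h2 := congrArg (fun F : C(ℝ, ℂ) => F t) h1
  simp only [ContinuousMap.add_apply, ContinuousMap.const_apply] at h2
  rw [← h2]
  ring

/-- The change of the argument of `γ t - z` as `t` runs from `0` to `1`
(zero if `γ` passes through `z`). -/
noncomputable def angleChange (γ : C(ℝ, ℂ)) (z : ℂ) : ℝ :=
  open Classical in
  if h : ∃ L : C(ℝ, ℂ), ∀ t, Complex.exp (L t) = γ t - z then (h.choose 1 - h.choose 0).im else 0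

theorem angleChange_eq {γ : C(ℝ, ℂ)} {z : ℂ} (L : C(ℝ, ℂ))
    (hL : ∀ t, Complex.exp (L t) = γ t - z) : angleChange γ z = (L 1 - L 0).im := by
  have h : ∃ L : C(ℝ, ℂ), ∀ t, Complex.exp (L t) = γ t - z := ⟨L, hL⟩
  rw [angleChange, dif_pos h, sub_eq_sub_of_exp_eq (L' := L)]
  intro t
  rw [hL, h.choose_spec]

theorem exp_add_pi_mul_I (z : ℂ) : Complex.exp (z + Real.pi * Complex.I) = - Complex.exp z := by
  rw [Complex.exp_add, Complex.exp_pi_mul_I]; ring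

/-- The four angle changes along the boundary of the square cancel for disjoint paths. -/
theorem angleChange_square (α β : C(ℝ, ℂ)) (h : ∀ s t, α s ≠ β t) :
    angleChange α (β 0) - angleChange α (β 1) + angleChange β (α 1) - angleChange β (α 0) = 0 := by
  obtain ⟨L, hL⟩ := exists_continuous_log (A := ℝ × ℝ) ⟨fun p => α p.1 - β p.2, by fun_prop⟩
    (fun p => sub_ne_zero.2 (h _ _))
  simp only [ContinuousMap.coe_mk] at hL
  have h1 : ∀ t, angleChange α (β t) = (L (1, t) - L (0, t)).im := fun t =>
    angleChange_eq ⟨fun s => L (s, t), by fun_prop⟩ (fun s => by simp [hL])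
  have h2 : ∀ s, angleChange β (α s) = (L (s, 1) - L (s, 0)).im := fun s => by
    -- The shift by π turns a logarithm of α s - β t into one of β t - α s.
    rw [angleChange_eq ⟨fun t => L (s, t) + Real.pi * Complex.I, by fun_prop⟩]
    · simp
    · intro t
      simp only [ContinuousMap.coe_mk, exp_add_pi_mul_I, hL]
      ring
  rw [h1, h1, h2, h2]
  simp only [Complex.sub_im]
  ring

theorem exists_im_eq_arg_add {L w : ℂ} (h : Complex.exp L = w) :
    ∃ m : ℤ, L.im = Complex.arg w + 2 * Real.pi * m := by
  have hw : w ≠ 0 := h ▸ Complex.exp_ne_zero L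
  have h1 : Complex.exp L = Complex.exp (Complex.log w) := by rw [Complex.exp_log hw, h]
  obtain ⟨m, hm⟩ := Complex.exp_eq_exp_iff_exists_int.1 h1
  refine ⟨m, ?_⟩
  rw [hm]
  simp [Complex.log_im]
  ring

variable {ι : Type*} [LinearOrder ι]

/-- An argument of `f v - f u`, chosen so that swapping `u` and `v` changes it by `±π`. -/
noncomputable def orderedArg (f : ι → ℂ) (u v : ι) : ℝ :=
  if u < v then Complex.arg (f v - f u) else Complex.arg (f u - f v) - Real.pi

theorem exists_im_eq_orderedArg_add (f : ι → ℂ) {u v : ι} {L : ℂ}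
    (h : Complex.exp L = f v - f u) :
    ∃ m : ℤ, L.im = orderedArg f u v + 2 * Real.pi * m := by
  unfold orderedArg
  split_ifs
  · exact exists_im_eq_arg_add h
  · obtain ⟨m, hm⟩ := exists_im_eq_arg_add (L := L + Real.pi * Complex.I) (w := f u - f v)
      (by rw [exp_add_pi_mul_I, h]; ring)
    refine ⟨m, ?_⟩
    simp at hm
    linarith

/-- The sign of the order relation between two distinct elements. -/
def orderSign (u v : ι) : ℤ := if u < v then 1 else -1

theorem orderedArg_swap (f : ι → ℂ) {u v : ι} (h : u ≠ v) :
    orderedArg f u v - orderedArg f v u = Real.pi * orderSign u v := by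
  unfold orderedArg orderSign
  rcases lt_or_gt_of_ne h with h | h
  · simp [h, h.not_gt]
  · simp [h, h.not_gt]

/-- The integrality relation between winding numbers for each pair of disjoint paths. -/
theorem exists_winding (f : ι → ℂ) (γ : ∀ i j, Path (f i) (f j)) :
    ∃ n : ι → ι → ι → ℤ, ∀ a b c d, a ≠ c → a ≠ d → b ≠ c → b ≠ d →
      Disjoint (Set.range (γ a b)) (Set.range (γ c d)) →
      orderSign a c + orderSign c b + orderSign b d + orderSign d a
        + 2 * (n c a b - n d a b + n b c d - n a c d) = 0 := by
  let g : ι → ι → C(ℝ, ℂ) := fun i j => ⟨(γ i j).extend, (γ i j).continuous_extend⟩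
  have g0 : ∀ i j, g i j 0 = f i := fun i j => (γ i j).extend_zero
  have g1 : ∀ i j, g i j 1 = f j := fun i j => (γ i j).extend_one
  have hg : ∀ i j t, g i j t ∈ Set.range (γ i j) := fun i j t => by
    rw [← (γ i j).extend_range]; exact ⟨t, rfl⟩
  -- The integer depends on one vertex and one path only, so different pairs of edges share
  -- unknowns; this is what the parity counts exploit.
  have h1 : ∀ v a b, ∃ n : ℤ, f v ∉ Set.range (γ a b) →
      angleChange (g a b) (f v) = orderedArg f v b - orderedArg f v a + 2 * Real.pi * n := by
    intro v a b
    by_cases hv : f v ∈ Set.range (γ a b)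
    · exact ⟨0, fun h => absurd hv h⟩
    obtain ⟨L, hL⟩ := exists_continuous_log (A := ℝ) ⟨fun t => g a b t - f v, by fun_prop⟩
      (fun t => sub_ne_zero.2 fun h => hv (h ▸ hg a b t))
    obtain ⟨m0, hm0⟩ := exists_im_eq_orderedArg_add f (u := v) (v := a) (L := L 0)
      (by rw [hL]; simp [g0])
    obtain ⟨m1, hm1⟩ := exists_im_eq_orderedArg_add f (u := v) (v := b) (L := L 1)
      (by rw [hL]; simp [g1])
    refine ⟨m1 - m0, fun _ => ?_⟩
    rw [angleChange_eq L hL, Complex.sub_im, hm0, hm1]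
    push_cast
    ring
  choose n hn using h1
  refine ⟨n, fun a b c d hac had hbc hbd hdis => ?_⟩
  rw [Set.disjoint_left] at hdis
  have e1 : ∀ i j, f i ∈ Set.range (γ i j) := fun i j => ⟨0, (γ i j).source⟩
  have e2 : ∀ i j, f j ∈ Set.range (γ i j) := fun i j => ⟨1, (γ i j).target⟩
  have key := angleChange_square (g a b) (g c d)
    (fun s t h => hdis (hg a b s) (h ▸ hg c d t))
  rw [g0, g0, g1, g1, hn c a b (fun h => hdis h (e1 _ _)), hn d a b (fun h => hdis h (e2 _ _)),
    hn b c d (hdis (e2 _ _)), hn a c d (hdis (e1 _ _))] at key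
  have s1 := orderedArg_swap f hac
  have s2 := orderedArg_swap f hbc.symm
  have s3 := orderedArg_swap f hbd
  have s4 := orderedArg_swap f had.symm
  have : Real.pi * ((orderSign a c + orderSign c b + orderSign b d + orderSign d a
        + 2 * (n c a b - n d a b + n b c d - n a c d) : ℤ) : ℝ) = 0 := by
    push_cast
    linear_combination key - s1 - s2 - s3 - s4
  have h0 := (mul_eq_zero.1 this).resolve_left Real.pi_ne_zero
  exact_mod_cast h0

end AngleChange

/-! ### Nonplanarity of K₅ and K₃,₃. -/

/-- `exists_winding` needs a path for every pair; pairs outside `E` get an arbitrary path in ℂ,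
about which nothing is claimed. -/
theorem joinedIn_winding {ι : Type*} [LinearOrder ι] (f : ι → ℂ) (T : ι → ι → Set ℂ)
    (E : ι → ι → Prop) (hT : ∀ i j, E i j → JoinedIn (T i j) (f i) (f j)) :
    ∃ n : ι → ι → ι → ℤ, ∀ a b c d, E a b → E c d → a ≠ c → a ≠ d → b ≠ c → b ≠ d →
      Disjoint (T a b) (T c d) →
      orderSign a c + orderSign c b + orderSign b d + orderSign d a
        + 2 * (n c a b - n d a b + n b c d - n a c d) = 0 := by
  have : ∀ i j, ∃ γ : Path (f i) (f j), E i j → Set.range γ ⊆ T i j := by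
    intro i j
    by_cases h : E i j
    · exact ⟨(hT i j h).somePath, fun _ => Set.range_subset_iff.2 (hT i j h).somePath_mem⟩
    · exact ⟨(PathConnectedSpace.joined _ _).somePath, fun h' => absurd h' h⟩
  choose γ hγ using this
  obtain ⟨n, hn⟩ := exists_winding f γ
  exact ⟨n, fun a b c d hab hcd h1 h2 h3 h4 h =>
    hn a b c d h1 h2 h3 h4 (h.mono (hγ _ _ hab) (hγ _ _ hcd))⟩

/-- `K₅` has no drawing in which disjoint edges do not meet. -/
theorem not_planar_five (f : Fin 5 → ℂ) (T : Fin 5 → Fin 5 → Set ℂ)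
    (hT : ∀ i j, i < j → JoinedIn (T i j) (f i) (f j))
    (hd : ∀ a b c d, a < b → c < d → a < c → a ≠ d → b ≠ c → b ≠ d →
      Disjoint (T a b) (T c d)) : False := by
  obtain ⟨n, hn⟩ := joinedIn_winding f T (· < ·) hT
  have key : ∀ a b c d : Fin 5, (a < b ∧ c < d ∧ a < c ∧ a ≠ d ∧ b ≠ c ∧ b ≠ d) →
      orderSign a c + orderSign c b + orderSign b d + orderSign d a
        + 2 * (n c a b - n d a b + n b c d - n a c d) = 0 := fun a b c d h =>
    hn a b c d h.1 h.2.1 h.2.2.1.ne h.2.2.2.1 h.2.2.2.2.1 h.2.2.2.2.2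
      (hd a b c d h.1 h.2.1 h.2.2.1 h.2.2.2.1 h.2.2.2.2.1 h.2.2.2.2.2)
  have k1 := key 0 1 2 3 (by decide)
  have k2 := key 0 1 2 4 (by decide)
  have k3 := key 0 1 3 4 (by decide)
  have k4 := key 0 2 1 3 (by decide)
  have k5 := key 0 2 1 4 (by decide)
  have k6 := key 0 2 3 4 (by decide)
  have k7 := key 0 3 1 2 (by decide)
  have k8 := key 0 3 1 4 (by decide)
  have k9 := key 0 3 2 4 (by decide)
  have k10 := key 0 4 1 2 (by decide)
  have k11 := key 0 4 1 3 (by decide)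
  have k12 := key 0 4 2 3 (by decide)
  have k13 := key 1 2 3 4 (by decide)
  have k14 := key 1 3 2 4 (by decide)
  have k15 := key 1 4 2 3 (by decide)
  -- The sign sum is 2 if the pairs interleave and 0 otherwise; 5 of the 15 pairs interleave. Each
  -- unknown `n v a b` occurs in two relations, one for each remaining end of an edge at `v`. Half
  -- the sum of all relations is therefore odd, yet zero.
  simp [orderSign] at k1 k2 k3 k4 k5 k6 k7 k8 k9 k10 k11 k12 k13 k14 k15
  omega

/-- `K₃,₃` has no drawing in which disjoint edges do not meet. -/
theorem not_planar_three_three (f : Fin 6 → ℂ) (T : Fin 6 → Fin 6 → Set ℂ)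
    (hT : ∀ i j, i < 3 → 3 ≤ j → JoinedIn (T i j) (f i) (f j))
    (hd : ∀ a b c d, a < 3 → c < 3 → 3 ≤ b → 3 ≤ d → a < c → b ≠ d →
      Disjoint (T a b) (T c d)) : False := by
  obtain ⟨n, hn⟩ := joinedIn_winding f T (fun i j => i < 3 ∧ 3 ≤ j) (fun i j h => hT i j h.1 h.2)
  have key : ∀ a b c d : Fin 6, (a < 3 ∧ c < 3 ∧ 3 ≤ b ∧ 3 ≤ d ∧ a < c ∧ b ≠ d) →
      orderSign a c + orderSign c b + orderSign b d + orderSign d a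
        + 2 * (n c a b - n d a b + n b c d - n a c d) = 0 := by
    rintro a b c d ⟨h1, h2, h3, h4, h5, h6⟩
    exact hn a b c d ⟨h1, h3⟩ ⟨h2, h4⟩ h5.ne (h1.trans_le h4).ne (h2.trans_le h3).ne' h6
      (hd a b c d h1 h2 h3 h4 h5 h6)
  have k1 := key 0 3 1 4 (by decide)
  have k2 := key 0 3 1 5 (by decide)
  have k3 := key 0 4 1 3 (by decide)
  have k4 := key 0 4 1 5 (by decide)
  have k5 := key 0 5 1 3 (by decide)
  have k6 := key 0 5 1 4 (by decide)
  have k7 := key 0 3 2 4 (by decide)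
  have k8 := key 0 3 2 5 (by decide)
  have k9 := key 0 4 2 3 (by decide)
  have k10 := key 0 4 2 5 (by decide)
  have k11 := key 0 5 2 3 (by decide)
  have k12 := key 0 5 2 4 (by decide)
  have k13 := key 1 3 2 4 (by decide)
  have k14 := key 1 3 2 5 (by decide)
  have k15 := key 1 4 2 3 (by decide)
  have k16 := key 1 4 2 5 (by decide)
  have k17 := key 1 5 2 3 (by decide)
  have k18 := key 1 5 2 4 (by decide)
  -- The same parity count: the sign sum is 2 exactly when `b < d`, which holds for 9 of the 18
  -- pairs, and each unknown again occurs twice.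
  simp [orderSign] at k1 k2 k3 k4 k5 k6 k7 k8 k9 k10 k11 k12 k13 k14 k15 k16 k17 k18
  omega

/-! ### Reachability inside a vertex set. -/

/-- `v` can be reached from `u` by a walk of `G` inside the set `S`. -/
def ReachIn {V : Type*} (G : SimpleGraph V) (S : Set V) (u v : V) : Prop :=
  u ∈ S ∧ Relation.ReflTransGen (fun x y => G.Adj x y ∧ y ∈ S) u v

namespace ReachIn

variable {V : Type*} {G : SimpleGraph V} {S T : Set V} {u v w : V}

theorem refl (h : u ∈ S) : ReachIn G S u u := ⟨h, .refl⟩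

theorem mem_left (h : ReachIn G S u v) : u ∈ S := h.1

theorem mem_right (h : ReachIn G S u v) : v ∈ S := by
  obtain ⟨h, h'⟩ := h
  cases h' with
  | refl => exact h
  | tail _ h => exact h.2

theorem tail (h : ReachIn G S u v) (ha : G.Adj v w) (hw : w ∈ S) : ReachIn G S u w :=
  ⟨h.1, h.2.tail ⟨ha, hw⟩⟩

theorem trans (h : ReachIn G S u v) (h' : ReachIn G S v w) : ReachIn G S u w :=
  ⟨h.1, h.2.trans h'.2⟩

theorem of_adj (ha : G.Adj u v) (hu : u ∈ S) (hv : v ∈ S) : ReachIn G S u v :=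
  (refl hu).tail ha hv

theorem symm (h : ReachIn G S u v) : ReachIn G S v u := by
  obtain ⟨hu, h⟩ := h
  induction h with
  | refl => exact refl hu
  | tail h1 h2 ih => exact (of_adj h2.1.symm h2.2 (mem_right ⟨hu, h1⟩)).trans ih

theorem mono (h : ReachIn G S u v) (hST : S ⊆ T) : ReachIn G T u v :=
  ⟨hST h.1, Relation.ReflTransGen.mono (fun _ _ h => ⟨h.1, hST h.2⟩) _ _ h.2⟩

theorem of_reachable_induce {x y : S} (h : (G.induce S).Reachable x y) :
    ReachIn G S x y := by
  obtain ⟨p⟩ := h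
  induction p with
  | nil => exact refl (Subtype.property _)
  | @cons a b _ ha _ ih =>
    exact trans (of_adj (SimpleGraph.induce_adj.1 ha) a.2 b.2) ih

/-- A walk that leaves a set `P` does so along an edge. -/
theorem exists_adj_of_mem_of_notMem {P : Set V} (h : ReachIn G S u v) (hu : u ∈ P) (hv : v ∉ P) :
    ∃ x y, x ∈ P ∧ y ∉ P ∧ G.Adj x y ∧ x ∈ S ∧ y ∈ S := by
  obtain ⟨huS, h⟩ := h
  induction h with
  | refl => exact absurd hu hv
  | @tail b c h1 h2 ih =>
    by_cases hb : b ∈ P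
    · exact ⟨b, c, hb, hv, h2.1, mem_right ⟨huS, h1⟩, h2.2⟩
    · exact ih hb

end ReachIn

/-! ### Topology of drawings of induced subgraphs. -/

namespace PlaneDrawing

variable {V : Type*} {G : SimpleGraph V}

/-- The part of a drawing over the subgraph induced on `S`. -/
def overSet (D : PlaneDrawing G) (S : Set V) : Set (EuclideanSpace ℝ (Fin 2)) :=
  D.vert '' S ∪ ⋃ e ∈ {e : G.edgeSet | ∀ v ∈ (e : Sym2 V), v ∈ S}, Set.range (D.edge e)

theorem mem_overSet {D : PlaneDrawing G} {S : Set V} {p : EuclideanSpace ℝ (Fin 2)} :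
    p ∈ D.overSet S ↔ (∃ v ∈ S, D.vert v = p) ∨
      ∃ e : G.edgeSet, (∀ v ∈ (e : Sym2 V), v ∈ S) ∧ ∃ t, D.edge e t = p := by
  simp only [overSet, Set.mem_union, Set.mem_image, Set.mem_iUnion, Set.mem_ofPred_eq, Set.mem_range,
    exists_prop]

theorem overSet_mono (D : PlaneDrawing G) {S T : Set V} (h : S ⊆ T) : D.overSet S ⊆ D.overSet T := by
  intro p hp
  rw [mem_overSet] at hp ⊢
  rcases hp with ⟨v, hv, rfl⟩ | ⟨e, he, t, rfl⟩
  · exact .inl ⟨v, h hv, rfl⟩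
  · exact .inr ⟨e, fun v hv => h (he v hv), t, rfl⟩

theorem overSet_subset_carrier (D : PlaneDrawing G) (S : Set V) : D.overSet S ⊆ D.carrier := by
  intro p hp
  rw [mem_overSet] at hp
  rcases hp with ⟨v, hv, rfl⟩ | ⟨e, he, t, rfl⟩
  · exact .inl ⟨v, rfl⟩
  · exact .inr (Set.mem_iUnion.2 ⟨e, t, rfl⟩)

theorem vert_mem_overSet_iff (D : PlaneDrawing G) {S : Set V} {v : V} :
    D.vert v ∈ D.overSet S ↔ v ∈ S := by
  rw [mem_overSet]
  constructor
  · rintro (⟨w, hw, h⟩ | ⟨e, he, t, h⟩)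
    · exact D.vert_injective h ▸ hw
    · exact he _ (D.mem_of_edge_eq_vert e t v h)
  · exact fun h => .inl ⟨v, h, rfl⟩

theorem disjoint_overSet (D : PlaneDrawing G) {S T : Set V} (h : Disjoint S T) :
    Disjoint (D.overSet S) (D.overSet T) := by
  rw [Set.disjoint_left] at h ⊢
  intro p hS hT
  have key : ∀ v, D.vert v = p → False := by
    rintro v rfl
    exact h (D.vert_mem_overSet_iff.1 hS) (D.vert_mem_overSet_iff.1 hT)
  rw [mem_overSet] at hS hT
  rcases hS with ⟨v, hv, hp⟩ | ⟨e, he, t, hp⟩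
  · exact key v hp
  rcases hT with ⟨v, hv, hp'⟩ | ⟨f, hf, s, hp'⟩
  · exact key v hp'
  obtain ⟨v, hv⟩ : ∃ v, v ∈ (e : Sym2 V) := ⟨_, Sym2.out_fst_mem _⟩
  have hef : e ≠ f := fun hef => h (he v hv) (hf v (hef ▸ hv))
  obtain ⟨w, hw⟩ := D.not_crossing e f hef t s (hp.trans hp'.symm)
  exact key w (hw.trans hp)

theorem isClosed_overSet [Finite V] (D : PlaneDrawing G) (S : Set V) : IsClosed (D.overSet S) := by
  refine ((Set.toFinite S).image _).isClosed.union ?_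
  exact Set.Finite.isClosed_biUnion (Set.toFinite _)
    fun e _ => (isCompact_range (D.edge e).continuous).isClosed

theorem isClosed_carrier [Finite V] (D : PlaneDrawing G) : IsClosed D.carrier :=
  (Set.finite_range _).isClosed.union
    (isClosed_iUnion_of_finite fun e => (isCompact_range (D.edge e).continuous).isClosed)

theorem joinedIn_overSet_of_adj (D : PlaneDrawing G) {S : Set V} {u v : V} (h : G.Adj u v)
    (hu : u ∈ S) (hv : v ∈ S) : JoinedIn (D.overSet S) (D.vert u) (D.vert v) := by
  let e : G.edgeSet := ⟨s(u, v), h⟩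
  have hS : ∀ w ∈ (e : Sym2 V), w ∈ S := by
    intro w hw
    rcases Sym2.mem_iff.1 hw with rfl | rfl <;> assumption
  have h1 : JoinedIn (D.overSet S) (D.edge e 0) (D.edge e 1) :=
    ⟨⟨D.edge e, rfl, rfl⟩, fun t => mem_overSet.2 (.inr ⟨e, hS, t, rfl⟩)⟩
  have h2 : s(D.edge e 0, D.edge e 1) = s(D.vert u, D.vert v) := D.edge_ends e
  rcases Sym2.eq_iff.1 h2 with ⟨h3, h4⟩ | ⟨h3, h4⟩
  · rwa [h3, h4] at h1
  · rw [h3, h4] at h1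
    exact h1.symm

theorem joinedIn_overSet (D : PlaneDrawing G) {S : Set V} {u v : V} (h : ReachIn G S u v) :
    JoinedIn (D.overSet S) (D.vert u) (D.vert v) := by
  obtain ⟨hu, h⟩ := h
  induction h with
  | refl => exact JoinedIn.refl (D.vert_mem_overSet_iff.2 hu)
  | tail h1 h2 ih =>
    exact ih.trans (D.joinedIn_overSet_of_adj h2.1 (ReachIn.mem_right ⟨hu, h1⟩) h2.2)

/-- The face is open and connected, hence path connected, and has points arbitrarily close to the
vertex; a segment covers the rest. That segment may cross edges at `v`, but it stays in a ball
missing the closed set drawn over the other vertices, so no accessibility of boundary points is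
required. -/
theorem joinedIn_compl_of_mem_frontier [Finite V] (D : PlaneDrawing G)
    {F : Set (EuclideanSpace ℝ (Fin 2))} (hF : D.IsFace F) {p : EuclideanSpace ℝ (Fin 2)}
    (hp : p ∈ F) {v : V} (hv : D.vert v ∈ frontier F) :
    JoinedIn (D.overSet {v}ᶜ)ᶜ p (D.vert v) := by
  obtain ⟨q, hq, rfl⟩ := hF
  have hopen : IsOpen (connectedComponentIn D.carrierᶜ q) :=
    D.isClosed_carrier.isOpen_compl.connectedComponentIn
  have hpc : IsPathConnected (connectedComponentIn D.carrierᶜ q) :=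
    (hopen.isConnected_iff_isPathConnected).1 (isConnected_connectedComponentIn_iff.2 hq)
  have hvK : D.vert v ∈ (D.overSet {v}ᶜ)ᶜ := fun h => D.vert_mem_overSet_iff.1 h rfl
  obtain ⟨ε, hε, hball⟩ := Metric.isOpen_iff.1 (D.isClosed_overSet {v}ᶜ).isOpen_compl _ hvK
  obtain ⟨r, hr, hrF⟩ := mem_closure_iff_nhds.1 (frontier_subset_closure hv) _
    (Metric.ball_mem_nhds _ hε)
  have h1 : JoinedIn (D.overSet {v}ᶜ)ᶜ p r := (hpc.joinedIn p hp r hrF).mono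
    ((connectedComponentIn_subset _ _).trans (Set.compl_subset_compl.2 (D.overSet_subset_carrier _)))
  exact h1.trans (JoinedIn.of_segment_subset
    (((convex_ball _ _).segment_subset hr (Metric.mem_ball_self hε)).trans hball))

/-- The complement on the right is where the spoke from the apex to `v` runs. -/
theorem disjoint_overSet_compl (D : PlaneDrawing G) {S : Set V} {v : V} (h : v ∉ S) :
    Disjoint (D.overSet S) (D.overSet {v}ᶜ)ᶜ :=
  Set.disjoint_compl_right_iff_subset.2
    (D.overSet_mono fun w hw (hwv : w = v) => h (hwv ▸ hw))

end PlaneDrawing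

/-! ### Forbidden configurations in outerplanar graphs. -/

namespace IsOuterplanar

variable {V : Type*} {G : SimpleGraph V}

/-- `p` acts as an extra vertex adjacent to all others. Its spokes may meet each other and the edges
at their own ends, which is harmless because the nonplanarity results only ask independent edges to
be disjoint. -/
theorem exists_apex [Finite V] (hG : IsOuterplanar G) : ∃ (D : PlaneDrawing G)
    (p : EuclideanSpace ℝ (Fin 2)), ∀ v, JoinedIn (D.overSet {v}ᶜ)ᶜ (D.vert v) p := by
  obtain ⟨D, F, ⟨hF, -⟩, hv⟩ := hG
  obtain ⟨p, hp, hFp⟩ := id hF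
  have : p ∈ F := hFp ▸ mem_connectedComponentIn hp
  exact ⟨D, p, fun v => (D.joinedIn_compl_of_mem_frontier hF this (hv v)).symm⟩

/-- An outerplanar graph has no four vertices joined pairwise by connected sets, such that sets
that belong to opposite pairs are disjoint. -/
theorem not_four_linked [Finite V] (hG : IsOuterplanar G) {w x y z : V}
    {Swx Swy Swz Sxy Sxz Syz : Set V}
    (wx : ReachIn G Swx w x) (wy : ReachIn G Swy w y) (wz : ReachIn G Swz w z)
    (xy : ReachIn G Sxy x y) (xz : ReachIn G Sxz x z) (yz : ReachIn G Syz y z)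
    (h1 : Disjoint Swx Syz) (h2 : Disjoint Swy Sxz) (h3 : Disjoint Swz Sxy) : False := by
  obtain ⟨D, p, hp⟩ := hG.exists_apex
  let φ := Complex.orthonormalBasisOneI.repr.symm
  have hφ : Continuous φ := φ.continuous
  have hi : Function.Injective φ := φ.injective
  let T : Fin 5 → Fin 5 → Set (EuclideanSpace ℝ (Fin 2)) :=
    ![![∅, D.overSet Swx, D.overSet Swy, D.overSet Swz, (D.overSet {w}ᶜ)ᶜ],
      ![∅, ∅, D.overSet Sxy, D.overSet Sxz, (D.overSet {x}ᶜ)ᶜ],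
      ![∅, ∅, ∅, D.overSet Syz, (D.overSet {y}ᶜ)ᶜ],
      ![∅, ∅, ∅, ∅, (D.overSet {z}ᶜ)ᶜ],
      ![∅, ∅, ∅, ∅, ∅]]
  let f : Fin 5 → EuclideanSpace ℝ (Fin 2) := ![D.vert w, D.vert x, D.vert y, D.vert z, p]
  refine not_planar_five (fun i => φ (f i)) (fun i j => φ '' T i j) ?_ ?_
  · intro i j hij
    refine JoinedIn.map ?_ hφ
    fin_cases i <;> fin_cases j <;> first | (exfalso; revert hij; decide) | skip
    exacts [D.joinedIn_overSet wx, D.joinedIn_overSet wy, D.joinedIn_overSet wz, hp w,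
      D.joinedIn_overSet xy, D.joinedIn_overSet xz, hp x, D.joinedIn_overSet yz, hp y, hp z]
  · intro a b c d hab hcd hac had hbc hbd
    rw [Set.disjoint_image_iff hi]
    fin_cases a <;> fin_cases c <;> first | (exfalso; revert hac; decide) | skip
    all_goals fin_cases b <;>
      first | (exfalso; revert hab; decide) | (exfalso; revert hbc; decide) | skip
    all_goals fin_cases d <;>
      first | (exfalso; revert hcd; decide) | (exfalso; revert hbd; decide) | skip
    all_goals first
      | exact D.disjoint_overSet h1
      | exact D.disjoint_overSet h2
      | exact D.disjoint_overSet h3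
      | exact D.disjoint_overSet_compl (h1.notMem_of_mem_left wx.mem_left)
      | exact (D.disjoint_overSet_compl (h1.notMem_of_mem_left wx.mem_left)).symm
      | exact D.disjoint_overSet_compl (h1.notMem_of_mem_left wx.mem_right)
      | exact (D.disjoint_overSet_compl (h1.notMem_of_mem_left wx.mem_right)).symm
      | exact D.disjoint_overSet_compl (h1.notMem_of_mem_right yz.mem_left)
      | exact (D.disjoint_overSet_compl (h1.notMem_of_mem_right yz.mem_left)).symm
      | exact D.disjoint_overSet_compl (h1.notMem_of_mem_right yz.mem_right)
      | exact (D.disjoint_overSet_compl (h1.notMem_of_mem_right yz.mem_right)).symm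
      | exact D.disjoint_overSet_compl (h2.notMem_of_mem_left wy.mem_left)
      | exact (D.disjoint_overSet_compl (h2.notMem_of_mem_left wy.mem_left)).symm
      | exact D.disjoint_overSet_compl (h2.notMem_of_mem_left wy.mem_right)
      | exact (D.disjoint_overSet_compl (h2.notMem_of_mem_left wy.mem_right)).symm
      | exact D.disjoint_overSet_compl (h2.notMem_of_mem_right xz.mem_left)
      | exact (D.disjoint_overSet_compl (h2.notMem_of_mem_right xz.mem_left)).symm
      | exact D.disjoint_overSet_compl (h2.notMem_of_mem_right xz.mem_right)
      | exact (D.disjoint_overSet_compl (h2.notMem_of_mem_right xz.mem_right)).symm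
      | exact D.disjoint_overSet_compl (h3.notMem_of_mem_left wz.mem_left)
      | exact (D.disjoint_overSet_compl (h3.notMem_of_mem_left wz.mem_left)).symm
      | exact D.disjoint_overSet_compl (h3.notMem_of_mem_left wz.mem_right)
      | exact (D.disjoint_overSet_compl (h3.notMem_of_mem_left wz.mem_right)).symm
      | exact D.disjoint_overSet_compl (h3.notMem_of_mem_right xy.mem_left)
      | exact (D.disjoint_overSet_compl (h3.notMem_of_mem_right xy.mem_left)).symm
      | exact D.disjoint_overSet_compl (h3.notMem_of_mem_right xy.mem_right)

/-- An outerplanar graph has no two vertices both joined to three vertices by connected sets, such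
that sets without a common end are disjoint. -/
theorem not_two_three_linked [Finite V] (hG : IsOuterplanar G) {x y : V} {v : Fin 3 → V}
    {A B : Fin 3 → Set V} (hA : ∀ i, ReachIn G (A i) x (v i)) (hB : ∀ i, ReachIn G (B i) y (v i))
    (hAB : ∀ i j, i ≠ j → Disjoint (A i) (B j)) : False := by
  obtain ⟨D, p, hp⟩ := hG.exists_apex
  let φ := Complex.orthonormalBasisOneI.repr.symm
  have hφ : Continuous φ := φ.continuous
  have hi : Function.Injective φ := φ.injective
  let T : Fin 6 → Fin 6 → Set (EuclideanSpace ℝ (Fin 2)) :=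
    ![![∅, ∅, ∅, D.overSet (A 0), D.overSet (A 1), D.overSet (A 2)],
      ![∅, ∅, ∅, D.overSet (B 0), D.overSet (B 1), D.overSet (B 2)],
      ![∅, ∅, ∅, (D.overSet {v 0}ᶜ)ᶜ, (D.overSet {v 1}ᶜ)ᶜ, (D.overSet {v 2}ᶜ)ᶜ],
      ![∅, ∅, ∅, ∅, ∅, ∅], ![∅, ∅, ∅, ∅, ∅, ∅], ![∅, ∅, ∅, ∅, ∅, ∅]]
  let f : Fin 6 → EuclideanSpace ℝ (Fin 2) :=
    ![D.vert x, D.vert y, p, D.vert (v 0), D.vert (v 1), D.vert (v 2)]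
  have hdA : ∀ i j, i ≠ j → Disjoint (D.overSet (A i)) (D.overSet {v j}ᶜ)ᶜ := fun i j hij =>
    D.disjoint_overSet_compl ((hAB i j hij).notMem_of_mem_right (hB j).mem_right)
  have hdB : ∀ i j, i ≠ j → Disjoint (D.overSet (B i)) (D.overSet {v j}ᶜ)ᶜ := fun i j hij =>
    D.disjoint_overSet_compl ((hAB j i hij.symm).notMem_of_mem_left (hA j).mem_right)
  have hdAB : ∀ i j, i ≠ j → Disjoint (D.overSet (A i)) (D.overSet (B j)) := fun i j hij =>
    D.disjoint_overSet (hAB i j hij)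
  refine not_planar_three_three (fun i => φ (f i)) (fun i j => φ '' T i j) ?_ ?_
  · intro i j hi3 hj
    refine JoinedIn.map ?_ hφ
    fin_cases i <;> first | (exfalso; revert hi3; decide) | skip
    all_goals fin_cases j <;> first | (exfalso; revert hj; decide) | skip
    exacts [D.joinedIn_overSet (hA 0), D.joinedIn_overSet (hA 1), D.joinedIn_overSet (hA 2),
      D.joinedIn_overSet (hB 0), D.joinedIn_overSet (hB 1), D.joinedIn_overSet (hB 2),
      (hp _).symm, (hp _).symm, (hp _).symm]
  · intro a b c d ha hc hb hd hac hbd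
    rw [Set.disjoint_image_iff hi]
    fin_cases a <;> fin_cases c <;>
      first | (exfalso; revert hac; decide) | (exfalso; revert hc; decide) | skip
    all_goals fin_cases b <;> first | (exfalso; revert hb; decide) | skip
    all_goals fin_cases d <;>
      first | (exfalso; revert hd; decide) | (exfalso; revert hbd; decide) | skip
    all_goals first
      | exact hdAB _ _ (by decide : (0 : Fin 3) ≠ 1)
      | exact hdAB _ _ (by decide : (0 : Fin 3) ≠ 2)
      | exact hdAB _ _ (by decide : (1 : Fin 3) ≠ 0)
      | exact hdAB _ _ (by decide : (1 : Fin 3) ≠ 2)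
      | exact hdAB _ _ (by decide : (2 : Fin 3) ≠ 0)
      | exact hdAB _ _ (by decide : (2 : Fin 3) ≠ 1)
      | exact hdA _ _ (by decide : (0 : Fin 3) ≠ 1)
      | exact hdA _ _ (by decide : (0 : Fin 3) ≠ 2)
      | exact hdA _ _ (by decide : (1 : Fin 3) ≠ 0)
      | exact hdA _ _ (by decide : (1 : Fin 3) ≠ 2)
      | exact hdA _ _ (by decide : (2 : Fin 3) ≠ 0)
      | exact hdA _ _ (by decide : (2 : Fin 3) ≠ 1)
      | exact hdB _ _ (by decide : (0 : Fin 3) ≠ 1)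
      | exact hdB _ _ (by decide : (0 : Fin 3) ≠ 2)
      | exact hdB _ _ (by decide : (1 : Fin 3) ≠ 0)
      | exact hdB _ _ (by decide : (1 : Fin 3) ≠ 2)
      | exact hdB _ _ (by decide : (2 : Fin 3) ≠ 0)
      | exact hdB _ _ (by decide : (2 : Fin 3) ≠ 1)

/-- An outerplanar graph has no two vertices with three disjoint connected sets attached to both. -/
theorem not_three_attached [Finite V] (hG : IsOuterplanar G) {x y : V} (hxy : x ≠ y)
    (C : Fin 3 → Set V) (hC : ∀ i, ∀ u ∈ C i, ∀ w ∈ C i, ReachIn G (C i) u w)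
    (hd : ∀ i j, i ≠ j → Disjoint (C i) (C j)) (hx : ∀ i, x ∉ C i) (hy : ∀ i, y ∉ C i)
    (hxC : ∀ i, ∃ u ∈ C i, G.Adj x u) (hyC : ∀ i, ∃ u ∈ C i, G.Adj y u) : False := by
  choose v hv hxv using hxC
  choose w hw hyw using hyC
  refine hG.not_two_three_linked (x := x) (y := y) (v := v) (A := fun i => insert x (C i))
    (B := fun i => insert y (C i))
    (fun i => ReachIn.of_adj (hxv i) (by simp) (by simp [hv i]))
    (fun i => (ReachIn.of_adj (hyw i) (by simp) (by simp [hw i])).trans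
      ((hC i _ (hw i) _ (hv i)).mono (Set.subset_insert _ _))) ?_
  intro i j hij
  rw [Set.disjoint_insert_left, Set.disjoint_insert_right]
  exact ⟨by simp [hxy, hx j], hy i, hd i j hij⟩

end IsOuterplanar

/-! ### Induced paths, components and shortest walks. -/

/-- The first `k` values of `f` form an induced path of `G`. -/
def IsInducedPathFun {V : Type*} (G : SimpleGraph V) (k : ℕ) (f : ℕ → V) : Prop :=
  ∀ i j, i < j → j < k → f i ≠ f j ∧ (G.Adj (f i) (f j) ↔ j = i + 1)

theorem IsInducedPathFun.hasInducedPath {V : Type*} {G : SimpleGraph V} {k : ℕ} {f : ℕ → V}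
    (h : IsInducedPathFun G k f) : HasInducedPath G k := by
  refine ⟨⟨⟨fun i => f i, ?_⟩, ?_⟩⟩
  · intro i j hij
    rcases lt_trichotomy (i : ℕ) j with h1 | h1 | h1
    · exact absurd hij (h i j h1 j.2).1
    · exact Fin.ext h1
    · exact absurd hij.symm (h j i h1 i.2).1
  · intro i j
    change G.Adj (f i) (f j) ↔ _
    rw [SimpleGraph.pathGraph_adj]
    rcases lt_trichotomy (i : ℕ) j with h1 | h1 | h1
    · rw [(h i j h1 j.2).2]; omega
    · rw [Fin.ext h1]; simp
    · rw [SimpleGraph.adj_comm, (h j i h1 i.2).2]; omega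

/-- Prepending the path `c 0, …, c i` to an induced path that starts at `c i`. -/
theorem IsInducedPathFun.prepend {V : Type*} {G : SimpleGraph V} {i k : ℕ} {c f : ℕ → V}
    {D : Set V} (hc : IsInducedPathFun G (i + 1) c) (hf : IsInducedPathFun G (k + 1) f)
    (h0 : f 0 = c i) (hD : ∀ t, 0 < t → t ≤ k → f t ∈ D) (hcD : ∀ s ≤ i, c s ∉ D)
    (hadj : ∀ s < i, ∀ y ∈ D, ¬ G.Adj (c s) y) :
    ∃ h : ℕ → V, IsInducedPathFun G (i + k + 1) h ∧ h 0 = c 0 ∧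
      ∀ t, 0 < t → t ≤ i + k → (t ≤ i ∧ h t = c t) ∨ h t ∈ D := by
  have hval : ∀ t, t ≤ i → (if t < i then c t else f (t - i)) = c t := by
    intro t ht
    split_ifs with h
    · rfl
    · rw [show t = i by omega, Nat.sub_self, h0]
  refine ⟨fun t => if t < i then c t else f (t - i), ?_, hval 0 (Nat.zero_le _), ?_⟩
  · intro s t hst htk
    by_cases ht : t ≤ i
    · simp only [hval t ht, hval s (by omega)]
      exact hc s t hst (by omega)
    · by_cases hs : s < i
      · have hft : f (t - i) ∈ D := hD _ (by omega) (by omega)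
        simp only [hs, if_true, show ¬ t < i by omega, if_false]
        refine ⟨fun h => hcD s hs.le (h ▸ hft), ?_⟩
        have := hadj s hs _ hft
        constructor
        · exact fun h => absurd h this
        · omega
      · simp only [hs, if_false, show ¬ t < i by omega]
        have := hf (s - i) (t - i) (by omega) (by omega)
        refine ⟨this.1, this.2.trans ?_⟩
        omega
  · intro t ht htk
    by_cases h : t ≤ i
    · exact .inl ⟨h, hval t h⟩
    · right
      simp only [show ¬ t < i by omega, if_false]
      exact hD _ (by omega) (by omega)

/-- The vertices that can be reached from `x` inside `U`. -/
def compIn {V : Type*} (G : SimpleGraph V) (U : Set V) (x : V) : Set V := {y | ReachIn G U x y}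

section compIn

variable {V : Type*} {G : SimpleGraph V} {U : Set V} {x y z : V}

theorem self_mem_compIn (h : x ∈ U) : x ∈ compIn G U x := ReachIn.refl h

theorem compIn_subset : compIn G U x ⊆ U := fun _ h => ReachIn.mem_right h

theorem reachIn_compIn (hy : y ∈ compIn G U x) (hz : z ∈ compIn G U x) :
    ReachIn G (compIn G U x) y z := by
  have key : ∀ y ∈ compIn G U x, ReachIn G (compIn G U x) x y := by
    intro y hy
    have hx := ReachIn.mem_left hy
    obtain ⟨-, hy⟩ := hy
    induction hy with
    | refl => exact ReachIn.refl (self_mem_compIn hx)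
    | tail h1 h2 ih => exact ih.tail h2.1 (ReachIn.tail ⟨hx, h1⟩ h2.1 h2.2)
  exact (key y hy).symm.trans (key z hz)

theorem mem_compIn_of_adj (hy : y ∈ compIn G U x) (h : G.Adj y z) (hz : z ∈ U) :
    z ∈ compIn G U x := ReachIn.tail hy h hz

theorem disjoint_compIn (h : y ∉ compIn G U x) : Disjoint (compIn G U x) (compIn G U y) :=
  Set.disjoint_left.2 fun _ h1 h2 => h (ReachIn.trans h1 (ReachIn.symm h2))

end compIn

section ShortestPath

variable {V : Type*} {G : SimpleGraph V} {a b : V} {C : Set V}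

/-- `c 0, …, c r` is a walk of `G` from `a` to `b` with interior in `C`. -/
structure IsWalkThrough (G : SimpleGraph V) (a b : V) (C : Set V) (r : ℕ) (c : ℕ → V) : Prop where
  two_le : 2 ≤ r
  start : c 0 = a
  finish : c r = b
  adj : ∀ i < r, G.Adj (c i) (c (i + 1))
  mem : ∀ i, 0 < i → i < r → c i ∈ C

theorem exists_isWalkThrough {u v : V} (hau : G.Adj a u) (hvb : G.Adj v b) (h : ReachIn G C u v) :
    ∃ r c, IsWalkThrough G a b C r c := by
  have key : ∃ (r : ℕ) (c : ℕ → V), 1 ≤ r ∧ c 0 = a ∧ c r = v ∧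
      (∀ i < r, G.Adj (c i) (c (i + 1))) ∧ ∀ i, 0 < i → i ≤ r → c i ∈ C := by
    clear hvb
    obtain ⟨hu, h⟩ := h
    induction h with
    | refl =>
      refine ⟨1, fun i => if i = 0 then a else u, le_rfl, by simp, by simp, ?_, ?_⟩
      · intro i hi
        simpa [show i = 0 by omega] using hau
      · intro i hi _
        simpa [hi.ne'] using hu
    | @tail v w _ h2 ih =>
      obtain ⟨r, c, hr, h0, hv, hadj, hmem⟩ := ih
      refine ⟨r + 1, fun i => if i ≤ r then c i else w, by omega, by simp [h0], by simp, ?_, ?_⟩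
      · intro i hi
        rcases Nat.lt_succ_iff_lt_or_eq.1 hi with hi | rfl
        · simpa [hi.le, Nat.succ_le_of_lt hi] using hadj i hi
        · simpa [hv] using h2.1
      · intro i hi _
        by_cases hir : i ≤ r
        · simpa [hir] using hmem i hi hir
        · simpa [hir] using h2.2
  obtain ⟨r, c, hr, h0, hv, hadj, hmem⟩ := key
  refine ⟨r + 1, fun i => if i ≤ r then c i else b, by omega, by simp [h0], by simp, ?_, ?_⟩
  · intro i hi
    rcases Nat.lt_succ_iff_lt_or_eq.1 hi with hi | rfl
    · simpa [hi.le, Nat.succ_le_of_lt hi] using hadj i hi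
    · simpa [hv] using hvb
  · intro i hi hir
    simpa [Nat.lt_succ_iff.1 hir] using hmem i hi (Nat.lt_succ_iff.1 hir)

/-- The excluded pair `(0, r)` is the edge `ab` itself, which would leave a walk of length 1 that
misses `C`. -/
theorem IsWalkThrough.shortcut {r : ℕ} {c : ℕ → V} (h : IsWalkThrough G a b C r c) {i j : ℕ}
    (hij : i + 1 < j) (hj : j ≤ r) (hadj : G.Adj (c i) (c j)) (hne : ¬ (i = 0 ∧ j = r)) :
    ∃ r' < r, ∃ c', IsWalkThrough G a b C r' c' := by
  refine ⟨r - (j - i - 1), by omega, fun t => if t ≤ i then c t else c (t + (j - i - 1)),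
    by omega, by simp [h.start], ?_, ?_, ?_⟩
  · simp only [show ¬ r - (j - i - 1) ≤ i by omega, if_false]
    rw [Nat.sub_add_cancel (by omega), h.finish]
  · intro t ht
    rcases lt_trichotomy t i with h1 | h1 | h1
    · simp only [h1.le, Nat.succ_le_of_lt h1, if_true]
      exact h.adj t (by omega)
    · simp only [h1, le_rfl, if_true, show ¬ i + 1 ≤ i by omega, if_false]
      rwa [show i + 1 + (j - i - 1) = j by omega]
    · simp only [show ¬ t ≤ i by omega, show ¬ t + 1 ≤ i by omega, if_false]
      rw [show t + 1 + (j - i - 1) = t + (j - i - 1) + 1 by omega]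
      exact h.adj _ (by omega)
  · intro t ht0 ht
    by_cases h1 : t ≤ i
    · simp only [h1, if_true]
      exact h.mem t ht0 (by omega)
    · simp only [h1, if_false]
      exact h.mem _ (by omega) (by omega)

/-- A shortest walk through `C` closes to an induced cycle with the edge `ab`. -/
theorem exists_induced_cycle (hab : G.Adj a b) (ha : a ∉ C) (hb : b ∉ C) {u v : V}
    (hau : G.Adj a u) (hvb : G.Adj v b) (h : ReachIn G C u v) :
    ∃ r c, IsWalkThrough G a b C r c ∧ (∀ i j, i < j → j ≤ r → c i ≠ c j) ∧
      ∀ i j, i < j → j ≤ r → G.Adj (c i) (c j) → j = i + 1 ∨ (i = 0 ∧ j = r) := by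
  classical
  have hex := exists_isWalkThrough hau hvb h
  obtain ⟨c, hc⟩ := Nat.find_spec hex
  have hmin : ¬ ∃ r' < Nat.find hex, ∃ c', IsWalkThrough G a b C r' c' :=
    fun ⟨r', h1, h2⟩ => Nat.find_min hex h1 h2
  have hind : ∀ i j, i < j → j ≤ Nat.find hex → G.Adj (c i) (c j) →
      j = i + 1 ∨ (i = 0 ∧ j = Nat.find hex) := by
    intro i j hij hj hadj
    by_contra hne
    rw [not_or] at hne
    exact hmin (hc.shortcut (by omega) hj hadj hne.2)
  refine ⟨_, c, hc, ?_, hind⟩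
  intro i j hij hj heq
  rcases hj.lt_or_eq with hj | hj
  · rcases hind i (j + 1) (by omega) hj (heq ▸ hc.adj j hj) with h1 | ⟨h1, h2⟩
    · omega
    · subst h1
      exact ha (hc.start ▸ heq ▸ hc.mem j hij hj)
  · rcases Nat.eq_zero_or_pos i with h0 | h0
    · rw [h0, hc.start, hj, hc.finish] at heq
      exact hab.ne heq
    · exact hb (hc.finish ▸ hj ▸ heq ▸ hc.mem i h0 (by omega))

end ShortestPath

/-! ### Connected sets attached to a cycle. -/

/-- `c 0, …, c r` are the vertices of a cycle of `G`, in this order. -/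
structure IsCycleFun {V : Type*} (G : SimpleGraph V) (r : ℕ) (c : ℕ → V) : Prop where
  two_le : 2 ≤ r
  adj : ∀ i < r, G.Adj (c i) (c (i + 1))
  adj_last : G.Adj (c 0) (c r)
  ne : ∀ i j, i < j → j ≤ r → c i ≠ c j

/-- Some vertex of `K` is adjacent to `v`. -/
def Attached {V : Type*} (G : SimpleGraph V) (K : Set V) (v : V) : Prop := ∃ y ∈ K, G.Adj y v

/-- Any two vertices of `K` are joined inside `K`. -/
def IsLinked {V : Type*} (G : SimpleGraph V) (K : Set V) : Prop :=
  ∀ u ∈ K, ∀ w ∈ K, ReachIn G K u w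

namespace IsCycleFun

variable {V : Type*} {G : SimpleGraph V} {r : ℕ} {c : ℕ → V}

theorem injOn (h : IsCycleFun G r c) {i j : ℕ} (hi : i ≤ r) (hj : j ≤ r) (hij : c i = c j) :
    i = j := by
  rcases lt_trichotomy i j with h1 | h1 | h1
  · exact absurd hij (h.ne i j h1 hj)
  · exact h1
  · exact absurd hij.symm (h.ne j i h1 hi)

theorem disjoint_image (h : IsCycleFun G r c) {M N : Set ℕ} (hM : ∀ i ∈ M, i ≤ r)
    (hN : ∀ j ∈ N, j ≤ r) (hMN : ∀ i ∈ M, i ∉ N) : Disjoint (c '' M) (c '' N) := by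
  rw [Set.disjoint_left]
  rintro _ ⟨i, hi, rfl⟩ ⟨j, hj, hji⟩
  exact hMN i hi (h.injOn (hM i hi) (hN j hj) hji.symm ▸ hj)

theorem disjoint_image_insert (h : IsCycleFun G r c) {M : Set ℕ} (hM : ∀ i ∈ M, i ≤ r)
    {K : Set V} (hK : ∀ j ≤ r, c j ∉ K) {k : ℕ} (hk : k ≤ r) (hkI : k ∉ M) :
    Disjoint (c '' M) (insert (c k) K) := by
  rw [Set.disjoint_left]
  rintro _ ⟨i, hi, rfl⟩ (h1 | h1)
  · exact hkI (h.injOn (hM i hi) hk h1 ▸ hi)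
  · exact hK i (hM i hi) h1

theorem reachIn_arc (h : IsCycleFun G r c) {M : Set ℕ} {i j : ℕ} (hij : i ≤ j) (hj : j ≤ r)
    (hM : ∀ t, i ≤ t → t ≤ j → t ∈ M) : ReachIn G (c '' M) (c i) (c j) := by
  induction j, hij using Nat.le_induction with
  | base => exact ReachIn.refl ⟨i, hM i le_rfl le_rfl, rfl⟩
  | succ j hij ih =>
    exact (ih (by omega) (fun t h1 h2 => hM t h1 (by omega))).tail (h.adj j hj)
      ⟨j + 1, hM _ (by omega) le_rfl, rfl⟩

theorem reachIn_insert {K : Set V} (hK : IsLinked G K) {v x : V} (hx : x ∈ K)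
    (hv : Attached G K v) : ReachIn G (insert v K) x v := by
  obtain ⟨y, hy, hyv⟩ := hv
  exact ((hK x hx y hy).mono (Set.subset_insert _ _)).tail hyv (Set.mem_insert _ _)

/-- A connected set off a cycle is attached to at most two of its vertices. -/
theorem not_attached_three [Finite V] (hG : IsOuterplanar G) (h : IsCycleFun G r c) {K : Set V}
    (hK : IsLinked G K) (hcK : ∀ j ≤ r, c j ∉ K) {j k l : ℕ} (hjk : j < k) (hkl : k < l)
    (hl : l ≤ r) (aj : Attached G K (c j)) (ak : Attached G K (c k)) (al : Attached G K (c l)) :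
    False := by
  obtain ⟨x, hx, -⟩ := id aj
  refine hG.not_four_linked (reachIn_insert hK hx aj) (reachIn_insert hK hx ak)
    (reachIn_insert hK hx al)
    (h.reachIn_arc (M := Set.Icc j k) hjk.le (by omega) fun t h1 h2 => ⟨h1, h2⟩)
    (Sxz := c '' (Set.Iic j ∪ Set.Icc l r)) ?_
    (h.reachIn_arc (M := Set.Icc k l) hkl.le (by omega) fun t h1 h2 => ⟨h1, h2⟩) ?_ ?_ ?_
  · have h1 : ReachIn G (c '' (Set.Iic j ∪ Set.Icc l r)) (c 0) (c j) :=
      h.reachIn_arc (Nat.zero_le _) (by omega) fun t _ h2 => .inl h2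
    have h2 : ReachIn G (c '' (Set.Iic j ∪ Set.Icc l r)) (c l) (c r) :=
      h.reachIn_arc hl le_rfl fun t h1 h2 => .inr ⟨h1, h2⟩
    exact (h1.symm.trans (ReachIn.of_adj h.adj_last h1.mem_left h2.mem_right)).trans h2.symm
  · refine (h.disjoint_image_insert ?_ hcK (by omega) ?_).symm
    · rintro i ⟨h1, h2⟩; omega
    · rintro ⟨h1, h2⟩; omega
  · refine (h.disjoint_image_insert ?_ hcK (by omega) ?_).symm
    · rintro i (h1 | ⟨h1, h2⟩)
      · exact (Set.mem_Iic.1 h1).trans (by omega)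
      · exact h2
    · rintro (h1 | ⟨h1, h2⟩)
      · have := Set.mem_Iic.1 h1
        omega
      · omega
  · refine (h.disjoint_image_insert ?_ hcK (by omega) ?_).symm
    · rintro i ⟨h1, h2⟩; omega
    · rintro ⟨h1, h2⟩; omega

/-- Two vertices of a cycle are joined along the arc through its closing edge. -/
theorem exists_outer_arc (h : IsCycleFun G r c) {j k : ℕ} (hjk : j < k) (hk : k ≤ r)
    (hne : ¬ (j = 0 ∧ k = r)) : ∃ (v : V) (M N : Set ℕ), ReachIn G (c '' M) (c j) v ∧
      ReachIn G (c '' N) (c k) v ∧ (∀ i ∈ M, i ≤ r ∧ (i ≤ j ∨ k < i)) ∧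
      ∀ i ∈ N, i ≤ r ∧ (i < j ∨ k ≤ i) := by
  -- The meeting vertex must lie strictly inside the outer arc: `c r` if `j = 0`, and `c 0`
  -- otherwise.
  rcases Nat.eq_zero_or_pos j with rfl | hj
  · refine ⟨c r, {0, r}, Set.Icc k r, ReachIn.of_adj h.adj_last ⟨0, by simp, rfl⟩ ⟨r, by simp, rfl⟩,
      h.reachIn_arc hk le_rfl fun t h1 h2 => ⟨h1, h2⟩, ?_, ?_⟩
    · rintro i (rfl | rfl) <;> omega
    · rintro i ⟨h1, h2⟩; omega
  · refine ⟨c 0, Set.Iic j, insert 0 (Set.Icc k r), ?_, ?_, ?_, ?_⟩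
    · exact (h.reachIn_arc (Nat.zero_le _) (by omega) fun t _ h2 => h2).symm
    · have h1 : ReachIn G (c '' (insert 0 (Set.Icc k r))) (c k) (c r) :=
        h.reachIn_arc hk le_rfl fun t h1 h2 => .inr ⟨h1, h2⟩
      exact h1.tail h.adj_last.symm ⟨0, .inl rfl, rfl⟩
    · intro i hi
      have := Set.mem_Iic.1 hi
      omega
    · rintro i (rfl | ⟨h1, h2⟩) <;> omega

/-- A connected set off a cycle is attached only to consecutive vertices. -/
theorem attached_consecutive [Finite V] (hG : IsOuterplanar G) (h : IsCycleFun G r c) {K : Set V}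
    (hK : IsLinked G K) (hcK : ∀ j ≤ r, c j ∉ K) {j k : ℕ} (hjk : j < k) (hk : k ≤ r)
    (aj : Attached G K (c j)) (ak : Attached G K (c k)) : k = j + 1 ∨ (j = 0 ∧ k = r) := by
  by_contra hne
  rw [not_or] at hne
  obtain ⟨hne1, hne2⟩ := hne
  obtain ⟨x, hx, -⟩ := id aj
  obtain ⟨v, M, N, hM, hN, hM', hN'⟩ := h.exists_outer_arc hjk hk hne2
  -- If `c j` and `c k` are not neighbours on the cycle, three routes join them: through `K`, along
  -- the inner arc and along the outer arc, each with an interior vertex.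
  refine hG.not_two_three_linked (x := c j) (y := c k) (v := ![x, c (j + 1), v])
    (A := ![insert (c j) K, c '' {j, j + 1}, c '' M])
    (B := ![insert (c k) K, c '' Set.Icc (j + 1) k, c '' N]) ?_ ?_ ?_
  · intro i
    fin_cases i
    · exact (reachIn_insert hK hx aj).symm
    · exact ReachIn.of_adj (h.adj j (by omega)) ⟨j, by simp, rfl⟩ ⟨j + 1, by simp, rfl⟩
    · exact hM
  · intro i
    fin_cases i
    · exact (reachIn_insert hK hx ak).symm
    · exact (h.reachIn_arc (M := Set.Icc (j + 1) k) (by omega) hk fun t h1 h2 => ⟨h1, h2⟩).symm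
    · exact hN
  · have hp : ∀ i ∈ ({j, j + 1} : Set ℕ), i = j ∨ i = j + 1 := fun i hi => by simpa using hi
    intro s t hst
    fin_cases s <;> fin_cases t <;> first | (exfalso; revert hst; decide) | skip
    · refine (h.disjoint_image_insert ?_ hcK (by omega) ?_).symm
      · rintro i ⟨h1, h2⟩; omega
      · rintro ⟨h1, h2⟩; omega
    · refine (h.disjoint_image_insert (fun i hi => (hN' i hi).1) hcK (by omega) ?_).symm
      intro hj
      have := hN' j hj
      omega
    · refine h.disjoint_image_insert ?_ hcK (by omega) ?_
      · intro i hi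
        have := hp i hi
        omega
      · intro hi
        have := hp _ hi
        omega
    · refine h.disjoint_image ?_ (fun i hi => (hN' i hi).1) ?_
      · intro i hi
        have := hp i hi
        omega
      · intro i hi hi2
        have h1 := hp _ hi
        have h2 := hN' i hi2
        omega
    · refine h.disjoint_image_insert (fun i hi => (hM' i hi).1) hcK (by omega) ?_
      intro hj
      have := hM' k hj
      omega
    · refine h.disjoint_image (fun i hi => (hM' i hi).1) ?_ ?_
      · rintro i ⟨h1, h2⟩; omega
      · rintro i hi ⟨h1, h2⟩
        have := hM' i hi
        omega

/-- Disjoint connected sets off a cycle are not attached to both ends of the same edge. -/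
theorem not_attached_twice [Finite V] (hG : IsOuterplanar G) (h : IsCycleFun G r c) {K K' : Set V}
    (hK : IsLinked G K) (hcK : ∀ j ≤ r, c j ∉ K) (hK' : IsLinked G K') (hcK' : ∀ j ≤ r, c j ∉ K')
    (hd : Disjoint K K') {i : ℕ} (hi : i < r)
    (ai : Attached G K (c i)) (aj : Attached G K (c (i + 1)))
    (ai' : Attached G K' (c i)) (aj' : Attached G K' (c (i + 1))) : False := by
  obtain ⟨x, hx, -⟩ := id ai
  obtain ⟨x', hx', -⟩ := id ai'
  have hr := h.two_le
  have hne := h.ne i (i + 1) (by omega) hi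
  obtain ⟨v, M, N, hM, hN, hM', hN'⟩ := h.exists_outer_arc (Nat.lt_succ_self i) hi (by omega)
  refine hG.not_two_three_linked (x := c i) (y := c (i + 1)) (v := ![x, x', v])
    (A := ![insert (c i) K, insert (c i) K', c '' M])
    (B := ![insert (c (i + 1)) K, insert (c (i + 1)) K', c '' N]) ?_ ?_ ?_
  · intro i
    fin_cases i
    · exact (reachIn_insert hK hx ai).symm
    · exact (reachIn_insert hK' hx' ai').symm
    · exact hM
  · intro i
    fin_cases i
    · exact (reachIn_insert hK hx aj).symm
    · exact (reachIn_insert hK' hx' aj').symm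
    · exact hN
  · have hMi : i + 1 ∉ M := fun h => by
      have := hM' _ h
      omega
    have hNi : i ∉ N := fun h => by
      have := hN' _ h
      omega
    intro s t hst
    fin_cases s <;> fin_cases t <;> first | (exfalso; revert hst; decide) | skip
    · change Disjoint (insert (c i) K) (insert (c (i + 1)) K')
      rw [Set.disjoint_insert_left, Set.disjoint_insert_right]
      exact ⟨by simp [hne, hcK' i hi.le], hcK _ hi, hd⟩
    · exact (h.disjoint_image_insert (fun i hi => (hN' i hi).1) hcK (by omega) hNi).symm
    · change Disjoint (insert (c i) K') (insert (c (i + 1)) K)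
      rw [Set.disjoint_insert_left, Set.disjoint_insert_right]
      exact ⟨by simp [hne, hcK i hi.le], hcK' _ hi, hd.symm⟩
    · exact (h.disjoint_image_insert (fun i hi => (hN' i hi).1) hcK' (by omega) hNi).symm
    · exact h.disjoint_image_insert (fun i hi => (hM' i hi).1) hcK (by omega) hMi
    · exact h.disjoint_image_insert (fun i hi => (hM' i hi).1) hcK' (by omega) hMi

end IsCycleFun

/-! ### The logarithmic bound. -/

section

variable {V : Type*} {G : SimpleGraph V}

theorem IsLinked.compIn (U : Set V) (x : V) : IsLinked G (compIn G U x) :=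
  fun _ hu _ hw => reachIn_compIn hu hw

/-- In a graph without cut vertices, a set with neighbours only in itself and in `{a, b}` is
attached to `a`. -/
theorem attached_of_forall_adj (hcut : ∀ v u w : V, u ≠ v → w ≠ v → ReachIn G {v}ᶜ u w)
    {a b x : V} (hab : a ≠ b) {C : Set V} (hx : x ∈ C) (ha : a ∉ C) (hb : b ∉ C)
    (hC : ∀ u ∈ C, ∀ w, G.Adj u w → w ∈ C ∨ w = a ∨ w = b) : Attached G C a := by
  obtain ⟨y, z, hy, hz, hyz, -, hzb⟩ :=
    (hcut b x a (fun h => hb (h ▸ hx)) hab).exists_adj_of_mem_of_notMem hx ha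
  rcases hC y hy z hyz with h | h | h
  · exact absurd h hz
  · exact ⟨y, hy, h ▸ hyz⟩
  · exact absurd h hzb

/-- In a cycle that is a shortest walk through `C`, every component of the rest of `C` is attached
to two consecutive vertices, and the components attached there coincide. -/
theorem exists_attached_succ [Finite V] (hG : IsOuterplanar G)
    (hcut : ∀ v u w : V, u ≠ v → w ≠ v → ReachIn G {v}ᶜ u w) {a b : V} {C : Set V}
    (ha : a ∉ C) (hb : b ∉ C) (hC : IsLinked G C)
    (hN : ∀ u ∈ C, ∀ w, G.Adj u w → w ∈ C ∨ w = a ∨ w = b) {r : ℕ} {c : ℕ → V}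
    (hw : IsWalkThrough G a b C r c) (hc : IsCycleFun G r c) {x : V}
    (hx : x ∈ C \ c '' Set.Iic r) : ∃ i < r, Attached G (compIn G (C \ c '' Set.Iic r) x) (c i) ∧
      Attached G (compIn G (C \ c '' Set.Iic r) x) (c (i + 1)) := by
  set K := compIn G (C \ c '' Set.Iic r) x with hKdef
  have hK : IsLinked G K := IsLinked.compIn _ _
  have hxK : x ∈ K := self_mem_compIn hx
  have hcK : ∀ j ≤ r, c j ∉ K := fun j hj h => (compIn_subset h).2 ⟨j, hj, rfl⟩
  have hKC : K ⊆ C := fun y hy => (compIn_subset hy).1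
  have hexit : ∀ y ∈ K, ∀ z, G.Adj y z → z ∉ K → ∃ j ≤ r, z = c j := by
    intro y hy z hyz hz
    by_cases hzc : z ∈ c '' Set.Iic r
    · obtain ⟨j, hj, rfl⟩ := hzc
      exact ⟨j, hj, rfl⟩
    · rcases hN y (hKC hy) z hyz with h | h | h
      · exact absurd (mem_compIn_of_adj hy hyz ⟨h, hzc⟩) hz
      · exact ⟨0, Nat.zero_le _, h.trans hw.start.symm⟩
      · exact ⟨r, le_rfl, h.trans hw.finish.symm⟩
  have hr := hc.two_le
  -- Since `c i` is not a cut vertex, `K` has an attachment other than `c i`.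
  have h2 : ∀ i ≤ r, ∃ j ≤ r, j ≠ i ∧ Attached G K (c j) := by
    intro i hi
    obtain ⟨k, hk, hki⟩ : ∃ k ≤ r, k ≠ i := by
      rcases Nat.eq_zero_or_pos i with h | h
      · exact ⟨1, by omega, by omega⟩
      · exact ⟨0, by omega, by omega⟩
    obtain ⟨y, z, hy, hz, hyz, -, hzi⟩ := (hcut (c i) x (c k) (fun h => hcK i hi (h ▸ hxK))
      (fun h => hki (hc.injOn hk hi h))).exists_adj_of_mem_of_notMem hxK (hcK k hk)
    obtain ⟨j, hj, rfl⟩ := hexit y hy z hyz hz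
    exact ⟨j, hj, fun h => hzi (h ▸ rfl), y, hy, hyz⟩
  obtain ⟨i, hi, -, hiK⟩ := h2 0 (Nat.zero_le _)
  obtain ⟨j, hj, hji, hjK⟩ := h2 i hi
  obtain ⟨s, t, hst, ht, hsK, htK⟩ :
      ∃ s t, s < t ∧ t ≤ r ∧ Attached G K (c s) ∧ Attached G K (c t) := by
    rcases lt_or_gt_of_ne hji with h | h
    · exact ⟨j, i, h, hi, hjK, hiK⟩
    · exact ⟨i, j, h, hj, hiK, hjK⟩
  rcases hc.attached_consecutive hG hK hcK hst ht hsK htK with rfl | ⟨rfl, rfl⟩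
  · exact ⟨s, by omega, hsK, htK⟩
  · exfalso
    -- Attachment to the edge `ab` is impossible: `K` also reaches `c 1` inside `C`, which produces
    -- a third attachment strictly between the ends.
    obtain ⟨y, z, hy, hz, hyz, -, hzC⟩ := (hC x hx.1 (c 1)
      (hw.mem 1 (by omega) (by omega))).exists_adj_of_mem_of_notMem hxK (hcK 1 (by omega))
    obtain ⟨k, hk, rfl⟩ := hexit y hy z hyz hz
    have hk0 : k ≠ 0 := fun h => ha (hw.start ▸ h ▸ hzC)
    have hkr : k ≠ t := fun h => hb (hw.finish ▸ h ▸ hzC)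
    exact hc.not_attached_three hG hK hcK (by omega : 0 < k) (by omega : k < t) le_rfl hsK
      ⟨y, hy, hyz⟩ htK

/-- A connected set `C` behind an edge `ab` contains, up to the ends `a` and `b`, two induced paths
starting at `a` and `b` whose total length is at least logarithmic in the size of `C`. -/
theorem exists_two_induced_paths [Finite V] (hG : IsOuterplanar G)
    (hcut : ∀ v u w : V, u ≠ v → w ≠ v → ReachIn G {v}ᶜ u w) (C : Set V) :
    ∀ a b : V, G.Adj a b → a ∉ C → b ∉ C → IsLinked G C →
      (∀ u ∈ C, ∀ w, G.Adj u w → w ∈ C ∨ w = a ∨ w = b) →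
      ∃ (k l : ℕ) (f g : ℕ → V), IsInducedPathFun G (k + 1) f ∧ IsInducedPathFun G (l + 1) g ∧
        f 0 = a ∧ g 0 = b ∧ (∀ t, 0 < t → t ≤ k → f t ∈ C) ∧ (∀ t, 0 < t → t ≤ l → g t ∈ C) ∧
        C.ncard + 1 ≤ 2 ^ (k + l) := by
  induction hm : C.ncard using Nat.strong_induction_on generalizing C with
  | _ m ih =>
  subst hm
  intro a b hab ha hb hC hN
  rcases C.eq_empty_or_nonempty with rfl | ⟨x, hx⟩
  · refine ⟨0, 0, fun _ => a, fun _ => b, ?_, ?_, rfl, rfl, ?_, ?_, by simp⟩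
    · intro i j h1 h2; omega
    · intro i j h1 h2; omega
    · intro t h1 h2; omega
    · intro t h1 h2; omega
  obtain ⟨u, hu, hua⟩ := attached_of_forall_adj hcut hab.ne hx ha hb hN
  obtain ⟨v, hv, hvb⟩ := attached_of_forall_adj hcut hab.ne' hx hb ha
    (fun u hu w h => (hN u hu w h).imp_right Or.symm)
  obtain ⟨r, c, hw, hne, hind⟩ := exists_induced_cycle hab ha hb hua.symm hvb (hC u hu v hv)
  have hc : IsCycleFun G r c := ⟨hw.two_le, hw.adj, by rwa [hw.start, hw.finish], hne⟩
  have hr := hc.two_le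
  set U := C \ c '' Set.Iic r with hU
  let D : ℕ → Set V := fun i =>
    {x ∈ U | Attached G (compIn G U x) (c i) ∧ Attached G (compIn G U x) (c (i + 1))}
  have hcU : ∀ x, ∀ j ≤ r, c j ∉ compIn G U x := fun x j hj h =>
    (compIn_subset h).2 ⟨j, hj, rfl⟩
  have hcD : ∀ i, ∀ j ≤ r, c j ∉ D i := fun i j hj h => h.1.2 ⟨j, hj, rfl⟩
  -- Each `D i` is thus empty or a single component.
  have hDcomp : ∀ i < r, ∀ x ∈ D i, D i = compIn G U x := by
    intro i hi x hx
    ext y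
    constructor
    · intro hy
      by_contra hxy
      exact hc.not_attached_twice hG (IsLinked.compIn U x) (hcU x) (IsLinked.compIn U y) (hcU y)
        (disjoint_compIn hxy) hi hx.2.1 hx.2.2 hy.2.1 hy.2.2
    · intro hy
      have : compIn G U y = compIn G U x := by
        ext z
        exact ⟨fun hz => hy.trans hz, fun hz => hy.symm.trans hz⟩
      refine ⟨compIn_subset hy, ?_⟩
      rw [this]
      exact hx.2
  -- vertices of the cycle attached to `D i`
  have hDadj : ∀ i < r, ∀ y ∈ D i, ∀ j ≤ r, G.Adj y (c j) → j = i ∨ j = i + 1 := by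
    intro i hi y hy j hj hyj
    by_contra hne
    rw [not_or] at hne
    have hj' : Attached G (compIn G U y) (c j) := ⟨y, self_mem_compIn hy.1, hyj⟩
    rcases lt_or_gt_of_ne hne.1 with h | h
    · exact hc.not_attached_three hG (IsLinked.compIn U y) (hcU y) h (Nat.lt_succ_self i) hi
        hj' hy.2.1 hy.2.2
    · exact hc.not_attached_three hG (IsLinked.compIn U y) (hcU y) (Nat.lt_succ_self i)
        (by omega : i + 1 < j) hj hy.2.1 hy.2.2 hj'
  have hDC : ∀ i, D i ⊆ C := fun i x hx => hx.1.1
  -- one of the sets `D i` is large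
  have hcover : C ⊆ c '' Set.Ioo 0 r ∪ ⋃ i ∈ Finset.range r, D i := by
    intro x hx
    by_cases hxc : x ∈ c '' Set.Iic r
    · obtain ⟨j, hj, rfl⟩ := hxc
      left
      refine ⟨j, ⟨Nat.pos_of_ne_zero ?_, lt_of_le_of_ne hj ?_⟩, rfl⟩
      · rintro rfl
        exact ha (hw.start ▸ hx)
      · rintro rfl
        exact hb (hw.finish ▸ hx)
    · right
      obtain ⟨i, hi, h1, h2⟩ := exists_attached_succ hG hcut ha hb hC hN hw hc ⟨hx, hxc⟩
      exact Set.mem_biUnion (Finset.mem_coe.2 (Finset.mem_range.2 hi)) ⟨⟨hx, hxc⟩, h1, h2⟩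
  -- The `r - 1` interior vertices of the walk and the extra 1 supply the `r` ones in the sum.
  have hcard : C.ncard + 1 ≤ ∑ i ∈ Finset.range r, ((D i).ncard + 1) := by
    have h1 : (c '' Set.Ioo 0 r).ncard ≤ r - 1 := by
      refine (Set.ncard_image_le (Set.finite_Ioo 0 r)).trans ?_
      rw [← Finset.coe_Ioo, Set.ncard_coe_finset, Nat.card_Ioo]
      omega
    have h2 : (⋃ i ∈ Finset.range r, D i).ncard ≤ ∑ i ∈ Finset.range r, (D i).ncard :=
      Finset.set_ncard_biUnion_le _ _
    have h3 := (Set.ncard_le_ncard hcover (Set.toFinite _)).trans (Set.ncard_union_le _ _)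
    rw [Finset.sum_add_distrib]
    simp only [Finset.sum_const, Finset.card_range, smul_eq_mul, mul_one]
    omega
  obtain ⟨i, hi, hDi⟩ : ∃ i < r, C.ncard + 1 ≤ r * ((D i).ncard + 1) := by
    by_contra! hcon
    obtain ⟨i, hi, hmax⟩ := Finset.exists_max_image (Finset.range r) (fun i => (D i).ncard + 1)
      ⟨0, Finset.mem_range.2 (by omega)⟩
    have h1 := Finset.sum_le_card_nsmul _ _ _ hmax
    rw [Finset.card_range, smul_eq_mul] at h1
    exact absurd (hcon i (Finset.mem_range.1 hi)) (by omega)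
  have hlt : (D i).ncard < C.ncard := by
    refine Set.ncard_lt_ncard ⟨hDC i, fun h => ?_⟩ (Set.toFinite _)
    exact hcD i 1 (by omega) (h (hw.mem 1 (by omega) (by omega)))
  obtain ⟨k, l, f, g, hf, hg, hf0, hg0, hfD, hgD, hkl⟩ := ih _ hlt (D i) rfl (c i) (c (i + 1))
    (hw.adj i hi) (hcD i i hi.le) (hcD i _ hi)
    (fun u hu w hw => by
      rw [hDcomp i hi u hu] at hw ⊢
      exact reachIn_compIn (self_mem_compIn hu.1) hw)
    (fun u hu w huw => by
      have hcyc : w ∈ c '' Set.Iic r → w ∈ D i ∨ w = c i ∨ w = c (i + 1) := by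
        rintro ⟨j, hj, rfl⟩
        rcases hDadj i hi u hu j hj huw with h | h
        · exact .inr (.inl (by rw [h]))
        · exact .inr (.inr (by rw [h]))
      by_cases hwc : w ∈ c '' Set.Iic r
      · exact hcyc hwc
      rcases hN u (hDC i hu) w huw with h | h | h
      · left
        rw [hDcomp i hi u hu]
        exact mem_compIn_of_adj (self_mem_compIn hu.1) huw ⟨h, hwc⟩
      · exact hcyc ⟨0, Nat.zero_le _, hw.start.trans h.symm⟩
      · exact hcyc ⟨r, le_refl r, hw.finish.trans h.symm⟩)
  obtain ⟨f', hf', hf'0, hf'C⟩ := IsInducedPathFun.prepend (i := i) (c := c) (D := D i)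
    (fun s t hst ht => ⟨hne s t hst (by omega), fun h => by
        have := hind s t hst (by omega) h
        omega, fun h => h ▸ hw.adj s (by omega)⟩)
    hf hf0 hfD (fun s hs => hcD i s (by omega)) (fun s hs y hy h => by
        have := hDadj i hi y hy s (by omega) h.symm
        omega)
  -- The second arc runs backwards from `c r = b` to `c (i + 1)` and has `r - 1 - i` edges.
  obtain ⟨g', hg', hg'0, hg'C⟩ := IsInducedPathFun.prepend (i := r - 1 - i) (c := fun t => c (r - t))
    (D := D i)
    (fun s t hst ht => ⟨(hne (r - t) (r - s) (by omega) (by omega)).symm, fun h => by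
        have := hind (r - t) (r - s) (by omega) (by omega) h.symm
        omega, fun h => by
        have := hw.adj (r - t) (by omega)
        rw [show r - t + 1 = r - s by omega] at this
        exact this.symm⟩)
    hg (by rw [hg0, show r - (r - 1 - i) = i + 1 by omega]) hgD
    (fun s hs => hcD i (r - s) (by omega)) (fun s hs y hy h => by
        have := hDadj i hi y hy (r - s) (by omega) h.symm
        omega)
  refine ⟨i + k, r - 1 - i + l, f', g', hf', hg', hf'0.trans hw.start, hg'0.trans hw.finish,
    ?_, ?_, ?_⟩
  · intro t ht htk
    rcases hf'C t ht htk with ⟨h1, h2⟩ | h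
    · rw [h2]
      exact hw.mem t ht (by omega)
    · exact hDC i h
  · intro t ht htk
    rcases hg'C t ht htk with ⟨h1, h2⟩ | h
    · rw [h2]
      exact hw.mem (r - t) (by omega) (by omega)
    · exact hDC i h
  · have h1 : r ≤ 2 ^ (r - 1) := by
      have := Nat.lt_two_pow_self (n := r - 1)
      omega
    calc C.ncard + 1 ≤ r * ((D i).ncard + 1) := hDi
      _ ≤ 2 ^ (r - 1) * 2 ^ (k + l) := Nat.mul_le_mul h1 hkl
      _ = 2 ^ (i + k + (r - 1 - i + l)) := by
        rw [← pow_add]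
        congr 1
        omega

end

theorem IsTwoConnected.reachIn_compl {V : Type*} {G : SimpleGraph V} (h : IsTwoConnected G)
    (v u w : V) (hu : u ≠ v) (hw : w ≠ v) : ReachIn G {v}ᶜ u w :=
  ReachIn.of_reachable_induce ((h.2.2 v).preconnected ⟨u, hu⟩ ⟨w, hw⟩)

theorem theorem3p2 {V : Type*} [Fintype V] (G : SimpleGraph V) (n : ℕ)
    (hn : Fintype.card V = n) (h2 : IsTwoConnected G) (hG : IsOuterplanar G) :
    ∃ k : ℕ, Real.logb 2 (n : ℝ) / 2 ≤ (k : ℝ) ∧ HasInducedPath G k := by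
  have hcut := h2.reachIn_compl
  have hn3 : 3 ≤ n := by rw [← hn, ← Nat.card_eq_fintype_card]; exact h2.1
  obtain ⟨a, v, w, hav, haw, hvw⟩ := Fintype.two_lt_card_iff.1 (show 2 < Fintype.card V by omega)
  obtain ⟨a', b, ha', -, hab, -, -⟩ :=
    (hcut w a v haw hvw).exists_adj_of_mem_of_notMem (P := {a}) rfl hav.symm
  rw [Set.mem_singleton_iff.1 ha'] at hab
  have hUN : ∀ x, ∀ u ∈ compIn G {a, b}ᶜ x, ∀ w, G.Adj u w →
      w ∈ compIn G {a, b}ᶜ x ∨ w = a ∨ w = b := by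
    intro x u hu w huw
    by_cases h : w = a ∨ w = b
    · exact .inr h
    · exact .inl (mem_compIn_of_adj hu huw h)
  have haU : ∀ x, a ∉ compIn G {a, b}ᶜ x := fun x h => compIn_subset h (.inl rfl)
  have hbU : ∀ x, b ∉ compIn G {a, b}ᶜ x := fun x h => compIn_subset h (.inr rfl)
  have hatt : ∀ x ∈ ({a, b}ᶜ : Set V), Attached G (compIn G {a, b}ᶜ x) a ∧
      Attached G (compIn G {a, b}ᶜ x) b := fun x hx =>
    ⟨attached_of_forall_adj hcut hab.ne (self_mem_compIn hx) (haU x) (hbU x) (hUN x),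
      attached_of_forall_adj hcut hab.ne' (self_mem_compIn hx) (hbU x) (haU x)
        (fun u hu w h => (hUN x u hu w h).imp_right Or.symm)⟩
  -- Two components cover the `n - 2` vertices other than `a` and `b`; take the larger one.
  obtain ⟨x, hx⟩ : ∃ x, n ≤ 2 * ((compIn G {a, b}ᶜ x).ncard + 1) := by
    have hfew : ∃ x y, ({a, b} : Set V)ᶜ ⊆ compIn G {a, b}ᶜ x ∪ compIn G {a, b}ᶜ y := by
      by_contra! hcon
      -- Only a vertex outside `{a, b}` is wanted here; the repeated arguments are placeholders.
      obtain ⟨x, hx, -⟩ := Set.not_subset.1 (hcon a a)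
      obtain ⟨y, hy, hxy⟩ := Set.not_subset.1 (hcon x x)
      obtain ⟨z, hz, hxyz⟩ := Set.not_subset.1 (hcon x y)
      rw [Set.mem_union, not_or] at hxy hxyz
      have d1 := disjoint_compIn hxy.1
      have d2 := disjoint_compIn hxyz.1
      have d3 := disjoint_compIn hxyz.2
      have hmem : ∀ i : Fin 3, (![x, y, z] : Fin 3 → V) i ∈ ({a, b} : Set V)ᶜ := by
        intro i
        fin_cases i <;> assumption
      refine hG.not_three_attached hab.ne (fun i => compIn G {a, b}ᶜ (![x, y, z] i))
        (fun i => IsLinked.compIn _ _) ?_ (fun i => haU _) (fun i => hbU _)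
        (fun i => ?_) (fun i => ?_)
      · intro i j hij
        fin_cases i <;> fin_cases j <;> first | (exfalso; revert hij; decide) | skip
        exacts [d1, d2, d1.symm, d3, d2.symm, d3.symm]
      · obtain ⟨u, hu, hua⟩ := (hatt _ (hmem i)).1
        exact ⟨u, hu, hua.symm⟩
      · obtain ⟨u, hu, hub⟩ := (hatt _ (hmem i)).2
        exact ⟨u, hu, hub.symm⟩
    obtain ⟨x, y, hxy⟩ := hfew
    have h1 := (Set.ncard_le_ncard hxy (Set.toFinite _)).trans (Set.ncard_union_le _ _)
    have h3 := Set.ncard_add_ncard_compl ({a, b} : Set V)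
    rw [Set.ncard_pair hab.ne, Nat.card_eq_fintype_card, hn] at h3
    rcases le_total (compIn G {a, b}ᶜ x).ncard (compIn G {a, b}ᶜ y).ncard with h | h
    · exact ⟨y, by omega⟩
    · exact ⟨x, by omega⟩
  obtain ⟨k, l, f, g, hf, hg, -, -, -, -, hkl⟩ := exists_two_induced_paths hG hcut
    (compIn G {a, b}ᶜ x) a b hab (haU x) (hbU x) (IsLinked.compIn _ _) (hUN x)
  have hlog : Real.logb 2 n ≤ k + l + 1 := by
    rw [Real.logb_le_iff_le_rpow (by norm_num) (by exact_mod_cast (by omega : 0 < n))]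
    have : n ≤ 2 ^ (k + l + 1) := by
      rw [pow_succ]
      omega
    have h' : (n : ℝ) ≤ 2 ^ (k + l + 1) := by exact_mod_cast this
    exact_mod_cast h'
  -- `k` and `l` count edges, so the longer path has at least `(k + l) / 2 + 1` vertices.
  rcases le_total k l with h | h
  · refine ⟨l + 1, ?_, hg.hasInducedPath⟩
    have : (k : ℝ) ≤ l := by exact_mod_cast h
    push_cast
    linarith
  · refine ⟨k + 1, ?_, hf.hasInducedPath⟩
    have : (l : ℝ) ≤ k := by exact_mod_cast h
    push_cast
    linarith
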